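/- Let $n\ge 2$, let $\mathcal K^n$ be the set of nonempty compact convex subsets of $\mathbb R^n$ with the Hausdorff metric, let $B_n$ be the closed Euclidean unit ball, and let $\mathrm{vol}$ be Lebesgue measure. The quermassintegrals $W_0(K),\dots,W_n(K)$ of $K\in\mathcal K^n$ are the real numbers given by the Steiner formula $$\mathrm{vol}(K+\rho B_n)=\sum_{i=0}^{n}\rho^i\binom{n}{i}W_i(K)\qquad\text{for all }\rho\ge 0,$$ which holds for every $K\in\mathcal K^n$ and determines them uniquely. Let $\Diamond:\mathcal K^n\to\mathcal K^n$ be an operator that is continuous, $\mathrm{GL}(n)$-covariant, i.e. $\Diamond(gK)=g\,\Diamond K$ for all $K\in\mathcal K^n$ and $g\in\mathrm{GL}(n)$, and non-trivial, i.e. $\Diamond K\ne\{0\}$ for some $K\in\mathcal K^n$. Then for every $i\in\{0,\dots,n-1\}$ there is a constant $c=c_{n,i,\Diamond}>0$ such that $$W_i(K)\le c\,W_i(\Diamond K)\qquad\text{for all }K\in\mathcal K^n.$$ In particular (case $i=0$), there is a constant $c>0$ such that $\mathrm{vol}(K)\le c\,\mathrm{vol}(\Diamond K)$ for all $K\in\mathcal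 K^n$. -/

import Mathlib

open MeasureTheory
open scoped Pointwise

namespace QuermassBM

/-- The space `𝒦ⁿ` of (nonempty) compact convex subsets of Euclidean space `ℝⁿ`, with Mathlib's
topology, that of the Hausdorff metric. -/
abbrev Body (n : ℕ) : Type := ConvexBody (EuclideanSpace ℝ (Fin n))

/-- The image `g K` of a convex body `K` under an element `g` of the general linear group. -/
def linearImage {n : ℕ} (g : EuclideanSpace ℝ (Fin n) ≃ₗ[ℝ] EuclideanSpace ℝ (Fin n))
    (K : Body n) : Body n where
  carrier := g '' (K : Set (EuclideanSpace ℝ (Fin n)))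
  convex' := K.convex.linear_image g.toLinearMap
  isCompact' := K.isCompact.image g.toLinearMap.continuous_of_finiteDimensional
  nonempty' := K.nonempty.image g

/-- `GL(n)`-covariance: `◇ (g K) = g (◇ K)` for every convex body `K` and every `g ∈ GL(n)`. -/
def IsGLCovariant {n : ℕ} (D : Body n → Body n) : Prop :=
  ∀ (g : EuclideanSpace ℝ (Fin n) ≃ₗ[ℝ] EuclideanSpace ℝ (Fin n)) (K : Body n),
    D (linearImage g K) = linearImage g (D K)

/-- An operator is trivial if its image consists only of the origin, that is, of the body `{0}`. -/
def IsTrivial {n : ℕ} (D : Body n → Body n) : Prop :=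
  ∀ K : Body n, D K = 0

/-- The closed Euclidean unit ball `Bₙ`. -/
def unitBall (n : ℕ) : Body n where
  carrier := Metric.closedBall 0 1
  convex' := convex_closedBall 0 1
  isCompact' := isCompact_closedBall 0 1
  nonempty' := ⟨0, Metric.mem_closedBall_self zero_le_one⟩

/-- The volume (`n`-dimensional Lebesgue measure) of a convex body, as a real number. -/
noncomputable def vol {n : ℕ} (K : Body n) : ℝ :=
  volume.real (K : Set (EuclideanSpace ℝ (Fin n)))

/-- `p` is a Steiner polynomial of `K`: `vol (K + ρ Bₙ) = p(ρ)` for all `ρ ≥ 0`. -/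
def IsSteinerPolynomial {n : ℕ} (K : Body n) (p : Polynomial ℝ) : Prop :=
  ∀ ρ : ℝ, 0 ≤ ρ → vol (K + ρ • unitBall n) = p.eval ρ

/-- There is at most one Steiner polynomial. -/
theorem IsSteinerPolynomial.unique {n : ℕ} {K : Body n} {p q : Polynomial ℝ}
    (hp : IsSteinerPolynomial K p) (hq : IsSteinerPolynomial K q) : p = q :=
  Polynomial.eq_of_infinite_eval_eq p q <| (Set.Ici_infinite (0 : ℝ)).mono
    fun ρ hρ => (hp ρ hρ).symm.trans (hq ρ hρ)

open Classical in
/-- The Steiner polynomial `ρ ↦ vol (K + ρ Bₙ)` of `K`. -/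
noncomputable def steinerPolynomial {n : ℕ} (K : Body n) : Polynomial ℝ :=
  if h : ∃ p : Polynomial ℝ, IsSteinerPolynomial K p then h.choose else 0

/-- The `i`-th quermassintegral `W_i(K)`, `0 ≤ i ≤ n`: the coefficient of `ρ ^ i` in the Steiner
polynomial of `K`, divided by the binomial coefficient `n.choose i`. -/
noncomputable def quermassintegral {n : ℕ} (i : ℕ) (K : Body n) : ℝ :=
  (steinerPolynomial K).coeff i / (n.choose i : ℝ)

/-- The operator `D` satisfies a Brunn-Minkowski type inequality for the functional `φ`, with the
constant written on the right-hand side. -/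
def SatisfiesBM {n : ℕ} (φ : Body n → ℝ) (D : Body n → Body n) : Prop :=
  ∃ c : ℝ, 0 < c ∧ ∀ K : Body n, φ K ≤ c * φ (D K)

end QuermassBM

/-!
The proof has two independent parts: the Steiner formula together with the monotonicity of the
quermassintegrals, and the inclusion of a fixed homothet of `K` in `D K` up to translation.

**Quermassintegrals.** For a convex body `K` and a vector `v`, the volume of `K + s [-v, v]` is an
affine function of `s ≥ 0`: the part of `K + [0, s + t] v` outside `K + [0, s] v` is a translate of
the part of `K + [0, t] v` outside `K` (`sweep_add_diff`). The slope `Φ (K + [-v, v]) - Φ K` of a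
monotone functional `Φ` that is affine in this sense is again such a functional; it is monotone as
the limit of `Φ (K + s [-v, v]) / s` for `s → ∞` (`IsSegmentAffine.slope`). Hence, for a zonotope
`Z`, the volume of `K + ρ Z` is a polynomial in `ρ` whose coefficients are monotone in `K`
(`IsSegmentAffine.exists_polynomial`), and its degree is at most `n` by its growth. The ball is a
limit of zonotopes (`exists_zonotope_near_unitBall`), because its support function is a multiple of
the average of `x ↦ |⟪x, u⟫|` over all `u` in the ball. Interpolation at `0, …, n` carries both
polynomiality and the monotonicity of the coefficients over to the limit.

**The operator.** By density of `GL(n)`, `D` commutes with all linear maps. Applied to maps of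
rank one, this shows that the image of `D K` under a linear functional depends only on the image of
`K` (`image_map_eq_image_map`). So the support function of `D K` at `f` is `F (min_K f) (max_K f)`
for one function `F`, and `(a, b) ↦ F (min a b) (max a b)` is the support function of the planar
projection of the body `D [e₁, e₂]`. Testing `D` on triangles shows that `F` decreases in its first
and increases in its second argument, so a point of `D [e₁, e₂]` where `a x + b y`, `a < b`, is
maximal has coordinates `x ≤ 0 ≤ y` (`sign_of_isMaxOn`). If `D` is non-trivial, one such point is
nonzero, and then `x K + y K ⊆ D K` for all `K` by separation (`exists_smul_add_smul_mem`). In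
particular `D K` contains a translate of `r K` for a fixed `r ≠ 0`, and monotonicity, translation
invariance and homogeneity of the quermassintegrals give the inequality.
-/

namespace QuermassBM

open Filter Topology Polynomial RealInnerProductSpace

/-! ### Functionals that are affine under adding segments -/


/-- The segment `[-v, v]` as a convex body. -/
def symmSegment {n : ℕ} (v : EuclideanSpace ℝ (Fin n)) : Body n where
  carrier := segment ℝ (-v) v
  convex' := convex_segment _ _
  isCompact' := by
    rw [segment_eq_image_lineMap]
    exact isCompact_Icc.image AffineMap.lineMap_continuous
  nonempty' := ⟨v, right_mem_segment ℝ (-v) v⟩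

/-- A functional on convex bodies that is monotone and, along each ray `s ↦ K + s [-v, v]`, `s ≥ 0`,
affine. -/
structure IsSegmentAffine {n : ℕ} (Φ : Body n → ℝ) : Prop where
  mono : Monotone Φ
  affine : ∀ (K : Body n) (v : EuclideanSpace ℝ (Fin n)) (s : ℝ), 0 ≤ s →
    Φ (K + s • symmSegment v) = Φ K + s * (Φ (K + symmSegment v) - Φ K)

lemma body_add_mono {n : ℕ} {K L : Body n} (h : K ≤ L) (M : Body n) : K + M ≤ L + M := by
  rw [← SetLike.coe_subset_coe] at h ⊢
  simpa only [ConvexBody.coe_add] using Set.add_subset_add_right h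

/-- The slope in direction `[-v, v]` is again monotone, because it is the limit of
`Φ (K + s [-v, v]) / s` as `s → ∞`. -/
lemma IsSegmentAffine.slope {n : ℕ} {Φ : Body n → ℝ} (hΦ : IsSegmentAffine Φ)
    (v : EuclideanSpace ℝ (Fin n)) :
    IsSegmentAffine fun K => Φ (K + symmSegment v) - Φ K where
  mono K L h := by
    have key : ∀ s : ℝ, 0 ≤ s → 0 ≤ (Φ L - Φ K) +
        s * ((Φ (L + symmSegment v) - Φ L) - (Φ (K + symmSegment v) - Φ K)) := by
      intro s hs
      have := hΦ.mono (body_add_mono h (s • symmSegment v))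
      rw [hΦ.affine K v s hs, hΦ.affine L v s hs] at this
      linarith
    by_contra! hlt
    set d := (Φ (L + symmSegment v) - Φ L) - (Φ (K + symmSegment v) - Φ K) with hd
    have hd0 : 0 < -d := by simp only [hd]; linarith
    have h0 : 0 ≤ Φ L - Φ K := sub_nonneg.2 (hΦ.mono h)
    have := key ((Φ L - Φ K + 1) / -d) (by positivity)
    have h2 : (Φ L - Φ K + 1) / -d * d = -(Φ L - Φ K + 1) := by
      have : d ≠ 0 := by linarith
      field_simp
    linarith
  affine K w s hs := by
    have h1 := hΦ.affine (K + symmSegment v) w s hs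
    have h2 := hΦ.affine K w s hs
    rw [add_right_comm K (symmSegment v), add_right_comm K (symmSegment v)] at h1
    linarith

/-- An additive monotone function on `[0, ∞)` is linear. -/
lemma eq_mul_of_additive_of_monotone {ψ : ℝ → ℝ}
    (hadd : ∀ s t, 0 ≤ s → 0 ≤ t → ψ (s + t) = ψ s + ψ t)
    (hmono : ∀ s t, 0 ≤ s → s ≤ t → ψ s ≤ ψ t) {x : ℝ} (hx : 0 ≤ x) : ψ x = x * ψ 1 := by
  have h0 : ψ 0 = 0 := by have := hadd 0 0 le_rfl le_rfl; simp at this; exact this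
  have hnat : ∀ (m : ℕ) (t : ℝ), 0 ≤ t → ψ (m * t) = m * ψ t := by
    intro m t ht
    induction m with
    | zero => simp [h0]
    | succ k ih =>
      push_cast
      rw [add_mul, one_mul, hadd _ _ (by positivity) ht, ih]; ring
  have h1 : 0 ≤ ψ 1 := h0 ▸ hmono 0 1 le_rfl zero_le_one
  have bound : ∀ m : ℕ, m * |ψ x - x * ψ 1| ≤ ψ 1 := by
    intro m
    have hmx : (0 : ℝ) ≤ m * x := by positivity
    have a1 := hmono _ _ (Nat.cast_nonneg _) (Nat.floor_le hmx)
    have a2 := hmono _ _ hmx (Nat.lt_floor_add_one (m * x)).le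
    have e1 := hnat ⌊m * x⌋₊ 1 zero_le_one
    have e2 := hnat (⌊m * x⌋₊ + 1) 1 zero_le_one
    push_cast at e2
    rw [mul_one] at e1 e2
    rw [hnat m x hx] at a1 a2
    rw [e1] at a1
    rw [e2] at a2
    have f1 := mul_le_mul_of_nonneg_right (Nat.floor_le hmx) h1
    have f2 := mul_le_mul_of_nonneg_right (Nat.lt_floor_add_one (m * x)).le h1
    rw [← Nat.abs_cast m, ← abs_mul, abs_le]
    constructor <;> nlinarith
  by_contra hne
  have hpos : 0 < |ψ x - x * ψ 1| := abs_pos.2 (sub_ne_zero.2 hne)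
  obtain ⟨m, hm⟩ := exists_nat_gt (ψ 1 / |ψ x - x * ψ 1|)
  rw [div_lt_iff₀ hpos] at hm
  linarith [bound m]

lemma vol_mono {n : ℕ} : Monotone (vol : Body n → ℝ) := fun _ L h =>
  measureReal_mono (SetLike.coe_subset_coe.2 h) L.isCompact.measure_lt_top.ne

/-- The one-sided sweep `K + [0, s] v` of a set. -/
def sweep {E : Type*} [AddCommGroup E] [Module ℝ E] (K : Set E) (v : E) (s : ℝ) : Set E :=
  {x | ∃ k ∈ K, ∃ r : ℝ, 0 ≤ r ∧ r ≤ s ∧ x = k + r • v}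

lemma sweep_mono {E : Type*} [AddCommGroup E] [Module ℝ E] (K : Set E) (v : E) {s t : ℝ}
    (h : s ≤ t) : sweep K v s ⊆ sweep K v t := by
  rintro x ⟨k, hk, r, h0, h1, rfl⟩
  exact ⟨k, hk, r, h0, h1.trans h, rfl⟩

lemma sweep_zero {E : Type*} [AddCommGroup E] [Module ℝ E] (K : Set E) (v : E) :
    sweep K v 0 = K := by
  ext x
  constructor
  · rintro ⟨k, hk, r, h0, h1, rfl⟩
    simpa [le_antisymm h1 h0] using hk
  · exact fun hx => ⟨x, hx, 0, le_rfl, le_rfl, by simp⟩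

/-- What the sweep of a convex set gains after time `s` is a translate of what it gains
from the start: on each line parallel to `v` both are half-open intervals of the same length. -/
lemma sweep_add_diff {E : Type*} [AddCommGroup E] [Module ℝ E] {K : Set E} (hK : Convex ℝ K)
    (v : E) {s t : ℝ} (hs : 0 ≤ s) :
    sweep K v (s + t) \ sweep K v s = (fun x => s • v + x) '' (sweep K v t \ K) := by
  ext x
  constructor
  · rintro ⟨⟨k, hk, r, h0, h1, rfl⟩, hn⟩
    have hrs : s < r := by
      by_contra! h
      exact hn ⟨k, hk, r, h0, h, rfl⟩
    refine ⟨k + (r - s) • v, ⟨⟨k, hk, r - s, by linarith, by linarith, rfl⟩, fun hmem => ?_⟩, ?_⟩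
    · exact hn ⟨_, hmem, s, hs, le_rfl, by module⟩
    · module
  · rintro ⟨y, ⟨⟨k, hk, r, h0, h1, rfl⟩, hy⟩, rfl⟩
    refine ⟨⟨k, hk, s + r, by linarith, by linarith, by module⟩, ?_⟩
    rintro ⟨k', hk', r', h0', h1', he⟩
    apply hy
    replace he : s • v + (k + r • v) = k' + r' • v := he
    -- `k + r v` lies between `k` and `k' = k + (r + s - r') v`
    have hk'e : k' = k + (r + (s - r')) • v := by
      have : k' = s • v + (k + r • v) - r' • v := by rw [he]; abel
      rw [this]; module
    rcases eq_or_lt_of_le (show 0 ≤ r + (s - r') by linarith) with h | h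
    · have : r = 0 := by linarith
      simpa [this] using hk
    · have hc := hK hk hk' (a := (s - r') / (r + (s - r'))) (b := r / (r + (s - r')))
        (div_nonneg (by linarith) h.le) (div_nonneg h0 h.le) (by field_simp; ring)
      convert hc using 1
      rw [hk'e, smul_add, smul_smul, ← add_assoc, ← add_smul]
      have e1 : (s - r') / (r + (s - r')) + r / (r + (s - r')) = 1 := by field_simp; ring
      have e2 : r / (r + (s - r')) * (r + (s - r')) = r := by field_simp
      rw [e1, e2, one_smul]

lemma coe_smul_symmSegment {n : ℕ} (v : EuclideanSpace ℝ (Fin n)) (s : ℝ) :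
    ((s • symmSegment v : Body n) : Set (EuclideanSpace ℝ (Fin n))) =
      {x | ∃ r : ℝ, -1 ≤ r ∧ r ≤ 1 ∧ x = (s * r) • v} := by
  ext x
  rw [ConvexBody.coe_smul]
  constructor
  · rintro ⟨_, ⟨a, b, ha, hb, hab, rfl⟩, rfl⟩
    exact ⟨b - a, by linarith, by linarith, by module⟩
  · rintro ⟨r, h0, h1, rfl⟩
    refine ⟨r • v, ⟨(1 - r) / 2, (1 + r) / 2, by linarith, by linarith, by ring, by module⟩, ?_⟩
    exact smul_smul _ _ _

/-- Up to a translation, `K + s [-v, v]` is the sweep `K + [0, 2 s] v`. -/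
lemma coe_add_smul_symmSegment {n : ℕ} (K : Body n) (v : EuclideanSpace ℝ (Fin n)) {s : ℝ}
    (hs : 0 ≤ s) :
    ((K + s • symmSegment v : Body n) : Set (EuclideanSpace ℝ (Fin n))) =
      (fun x => -(s • v) + x) '' sweep (K : Set _) v (2 * s) := by
  rw [ConvexBody.coe_add, coe_smul_symmSegment]
  ext x
  constructor
  · rintro ⟨k, hk, _, ⟨r, h0, h1, rfl⟩, rfl⟩
    refine ⟨k + (s * r + s) • v, ⟨k, hk, _, by nlinarith, by nlinarith, rfl⟩, ?_⟩
    dsimp only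
    module
  · rintro ⟨_, ⟨k, hk, r, h0, h1, rfl⟩, rfl⟩
    rcases hs.eq_or_lt with rfl | hs
    · refine ⟨k, hk, 0, ⟨0, by norm_num, by norm_num, by simp⟩, ?_⟩
      simp [show r = 0 by linarith]
    · refine ⟨k, hk, (r - s) • v, ⟨(r - s) / s, ?_, ?_, ?_⟩, ?_⟩
      · rw [le_div_iff₀ hs]; linarith
      · rw [div_le_iff₀ hs]; linarith
      · congr 1; field_simp
      · dsimp only
        module

lemma measureReal_image_add_left {n : ℕ} (x : EuclideanSpace ℝ (Fin n))
    (S : Set (EuclideanSpace ℝ (Fin n))) :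
    volume.real ((fun y => x + y) '' S) = volume.real S := by
  simp [measureReal_def]

/-- The volume is affine along `s ↦ K + s [-v, v]`. -/
lemma isSegmentAffine_vol {n : ℕ} : IsSegmentAffine (vol : Body n → ℝ) where
  mono := vol_mono
  affine K v s hs := by
    have hv : ∀ t : ℝ, 0 ≤ t → vol (K + t • symmSegment v) =
        volume.real (sweep (K : Set _) v (2 * t)) := fun t ht => by
      rw [vol, coe_add_smul_symmSegment K v ht, measureReal_image_add_left]
    have himg : ∀ t : ℝ, 0 ≤ t → sweep (K : Set _) v t =
        (fun x => (t / 2) • v + x) '' ((K + (t / 2) • symmSegment v : Body n) : Set _) := by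
      intro t ht
      rw [coe_add_smul_symmSegment K v (by linarith), Set.image_image]
      simp [mul_div_cancel₀]
    have hc : ∀ t : ℝ, 0 ≤ t → IsCompact (sweep (K : Set _) v t) := fun t ht => by
      rw [himg t ht]
      exact (ConvexBody.isCompact _).image (continuous_const.add continuous_id)
    have hKs : ∀ t : ℝ, 0 ≤ t → (K : Set _) ⊆ sweep (K : Set _) v t := fun t ht => by
      conv_lhs => rw [← sweep_zero (K : Set _) v]
      exact sweep_mono _ v ht
    have hadd : ∀ a b : ℝ, 0 ≤ a → 0 ≤ b →
        volume.real (sweep (K : Set _) v (a + b)) - vol K =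
          (volume.real (sweep (K : Set _) v a) - vol K) +
            (volume.real (sweep (K : Set _) v b) - vol K) := by
      intro a b ha hb
      have e1 := measureReal_sdiff (μ := volume)
        (sweep_mono (K : Set _) v (show a ≤ a + b by linarith))
        (hc a ha).measurableSet (hc (a + b) (add_nonneg ha hb)).measure_lt_top.ne
      have e2 := measureReal_sdiff (μ := volume) (hKs b hb)
        K.isCompact.measurableSet (hc b hb).measure_lt_top.ne
      rw [sweep_add_diff K.convex v ha, measureReal_image_add_left] at e1
      simp only [vol]
      linarith
    have hmono : ∀ a b : ℝ, 0 ≤ a → a ≤ b →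
        volume.real (sweep (K : Set _) v a) - vol K ≤
          volume.real (sweep (K : Set _) v b) - vol K := by
      intro a b ha hab
      have := measureReal_mono (μ := volume) (sweep_mono (K : Set _) v hab)
        (hc b (ha.trans hab)).measure_lt_top.ne
      simpa using this
    have h1 := hv 1 zero_le_one
    rw [one_smul, mul_one] at h1
    rw [hv s hs, h1]
    linear_combination
      eq_mul_of_additive_of_monotone hadd hmono (show 0 ≤ 2 * s by linarith) -
        s * eq_mul_of_additive_of_monotone hadd hmono (show (0 : ℝ) ≤ 2 by norm_num)

/-! ### Zonotopes and polynomial expansions -/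

/-- The zonotope `∑ [-v, v]`, the sum running over the vectors `v` of a list. -/
noncomputable def zonotope {n : ℕ} : List (EuclideanSpace ℝ (Fin n)) → Body n
  | [] => 0
  | v :: l => symmSegment v + zonotope l

/-- Expansion of a segment-affine functional along a zonotope, with monotone coefficients. -/
lemma IsSegmentAffine.exists_polynomial {n : ℕ} (l : List (EuclideanSpace ℝ (Fin n))) :
    ∀ {Φ : Body n → ℝ}, IsSegmentAffine Φ → ∃ p : Body n → ℝ[X],
      (∀ K ρ, 0 ≤ ρ → Φ (K + ρ • zonotope l) = (p K).eval ρ) ∧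
        ∀ i, Monotone fun K => (p K).coeff i := by
  induction l with
  | nil =>
    intro Φ hΦ
    refine ⟨fun K => C (Φ K), fun K ρ _ => ?_, fun i K L h => ?_⟩
    · have h : K + ρ • zonotope [] = K := (congrArg (K + ·) (smul_zero ρ)).trans (add_zero K)
      rw [h, eval_C]
    by_cases hi : i = 0 <;> simp [coeff_C, hi, hΦ.mono h]
  | cons v l ih =>
    intro Φ hΦ
    obtain ⟨p, hp, hpm⟩ := ih hΦ
    obtain ⟨q, hq, hqm⟩ := ih (hΦ.slope v)
    refine ⟨fun K => p K + X * q K, fun K ρ hρ => ?_, fun i K L h => ?_⟩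
    · rw [zonotope, smul_add, add_comm (ρ • symmSegment v), ← add_assoc, hΦ.affine _ _ _ hρ,
        hq K ρ hρ, hp K ρ hρ]
      simp
    · cases i with
      | zero => simpa using hpm 0 h
      | succ i => simpa using add_le_add (hpm (i + 1) h) (hqm i h)

lemma vol_smul {n : ℕ} (t : ℝ) (K : Body n) : vol (t • K) = |t| ^ n * vol K := by
  rw [vol, ConvexBody.coe_smul, measureReal_def, Measure.addHaar_smul]
  simp [vol, measureReal_def, abs_pow]

lemma vol_nonneg {n : ℕ} (K : Body n) : 0 ≤ vol K := measureReal_nonneg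

/-- With `x ∈ K`, the body `(t - 1) x + K + t M` is contained in `t (K + M)`. -/
lemma vol_add_smul_le {n : ℕ} (K M : Body n) {t : ℝ} (ht : 1 ≤ t) :
    vol (K + t • M) ≤ t ^ n * vol (K + M) := by
  have h := vol_smul t (K + M)
  rw [abs_of_nonneg (by linarith)] at h
  rw [← h]
  obtain ⟨x, hx⟩ := K.nonempty
  rw [vol, ← measureReal_image_add_left ((t - 1) • x)]
  refine measureReal_mono ?_ (ConvexBody.isCompact _).measure_lt_top.ne
  rintro _ ⟨_, ⟨k, hk, _, ⟨m, hm, rfl⟩, rfl⟩, rfl⟩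
  have ht0 : t ≠ 0 := by linarith
  refine ⟨(((t - 1) / t) • x + (1 / t) • k) + m, ⟨_, ?_, m, hm, rfl⟩, ?_⟩
  · exact K.convex hx hk (div_nonneg (by linarith) (by linarith)) (by positivity)
      (by field_simp; ring)
  · change t • (((t - 1) / t) • x + (1 / t) • k + m) = (t - 1) • x + (k + t • m)
    rw [smul_add, smul_add, smul_smul, smul_smul, mul_div_cancel₀ _ ht0, mul_div_cancel₀ _ ht0]
    module

lemma le_vol_add_smul {n : ℕ} (K M : Body n) {t : ℝ} (ht0 : 0 < t) (ht : t ≤ 1) :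
    t ^ n * vol (K + M) ≤ vol (K + t • M) := by
  have h := vol_add_smul_le K (t • M) ((one_le_inv₀ ht0).2 ht)
  rw [smul_smul, inv_mul_cancel₀ ht0.ne', one_smul, inv_pow] at h
  rwa [← le_inv_mul_iff₀ (by positivity)]

lemma smul_body_mono {n : ℕ} {M N : Body n} (h : M ≤ N) (ρ : ℝ) : ρ • M ≤ ρ • N := by
  rw [← SetLike.coe_subset_coe] at h ⊢
  simpa only [ConvexBody.coe_smul] using Set.smul_set_mono h

lemma add_body_mono {n : ℕ} (K : Body n) {M N : Body n} (h : M ≤ N) : K + M ≤ K + N := by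
  rw [add_comm K, add_comm K]
  exact body_add_mono h K

/-- The volume of `K + ρ Z` has growth of order at most `n` in `ρ`, whence the degree bound. -/
lemma degree_le_of_eval_eq_vol {n : ℕ} (K Z : Body n) {p : ℝ[X]}
    (hp : ∀ ρ, 0 ≤ ρ → vol (K + ρ • Z) = p.eval ρ) : p.degree ≤ n := by
  by_contra! hlt
  have hq : ((X : ℝ[X]) ^ n).degree < p.degree := by simpa using hlt
  have hp0 : p ≠ 0 := by rintro rfl; simp at hlt
  have hO : p.eval =O[atTop] ((X : ℝ[X]) ^ n).eval := by
    refine Asymptotics.IsBigO.of_bound (vol (K + Z)) ?_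
    filter_upwards [eventually_ge_atTop 1] with ρ hρ
    have h0 : 0 ≤ ρ := by linarith
    rw [← hp ρ h0, Real.norm_of_nonneg (vol_nonneg _), eval_pow, eval_X,
      Real.norm_of_nonneg (by positivity), mul_comm]
    exact vol_add_smul_le K Z hρ
  have := hO.trans_isLittleO (isLittleO_atTop_of_degree_lt _ _ hq)
  exact Asymptotics.isLittleO_irrefl (eventually_atTop_not_isRoot p hp0).frequently this

/-! ### Interpolation and passage to the limit -/

/-- A polynomial of degree at most `n` interpolating `ρ ↦ vol (K + ρ M)` at `0, …, n`. -/
noncomputable def volInterpolant {n : ℕ} (K M : Body n) : ℝ[X] :=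
  Lagrange.interpolate (Finset.range (n + 1)) (fun i : ℕ => (i : ℝ))
    fun i => vol (K + (i : ℝ) • M)

lemma eq_volInterpolant {n : ℕ} (K Z : Body n) {p : ℝ[X]}
    (hp : ∀ ρ, 0 ≤ ρ → vol (K + ρ • Z) = p.eval ρ) : p = volInterpolant K Z := by
  refine Lagrange.eq_interpolate_of_eval_eq _ Nat.cast_injective.injOn ?_ ?_
  · rw [Finset.card_range]
    exact (degree_le_of_eval_eq_vol K Z hp).trans_lt (by exact_mod_cast Nat.lt_succ_self n)
  · exact fun i _ => (hp i (Nat.cast_nonneg i)).symm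

/-- If the bodies `Z k` converge to the unit ball in the sense of dilates, the volumes of
`K + ρ Z k` converge to that of the parallel body. -/
lemma tendsto_vol_add_smul {n : ℕ} {Z : ℕ → Body n} {ε : ℕ → ℝ} (hε : Tendsto ε atTop (𝓝 0))
    (hpos : ∀ k, 0 < ε k) (hlt : ∀ k, ε k < 1)
    (hZ : ∀ k, (1 - ε k) • unitBall n ≤ Z k ∧ Z k ≤ (1 + ε k) • unitBall n)
    (K : Body n) (ρ : ℝ) :
    Tendsto (fun k => vol (K + ρ • Z k)) atTop (𝓝 (vol (K + ρ • unitBall n))) := by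
  have hlow : Tendsto (fun k => (1 - ε k) ^ n * vol (K + ρ • unitBall n)) atTop
      (𝓝 (vol (K + ρ • unitBall n))) := by
    simpa using ((tendsto_const_nhds (x := (1 : ℝ))).sub hε |>.pow n).mul_const
      (vol (K + ρ • unitBall n))
  have hup : Tendsto (fun k => (1 + ε k) ^ n * vol (K + ρ • unitBall n)) atTop
      (𝓝 (vol (K + ρ • unitBall n))) := by
    simpa using ((tendsto_const_nhds (x := (1 : ℝ))).add hε |>.pow n).mul_const
      (vol (K + ρ • unitBall n))
  refine tendsto_of_tendsto_of_tendsto_of_le_of_le hlow hup (fun k => ?_) fun k => ?_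
  · refine (le_vol_add_smul K _ (by linarith [hlt k]) (by linarith [hpos k])).trans (vol_mono ?_)
    rw [smul_comm]
    exact add_body_mono K (smul_body_mono (hZ k).1 ρ)
  · refine (vol_mono ?_).trans (vol_add_smul_le K _ (by linarith [hpos k]))
    rw [smul_comm (1 + ε k)]
    exact add_body_mono K (smul_body_mono (hZ k).2 ρ)

lemma tendsto_volInterpolant_coeff {n : ℕ} {Z : ℕ → Body n} {M : Body n} {K : Body n}
    (h : ∀ ρ : ℝ, Tendsto (fun k => vol (K + ρ • Z k)) atTop (𝓝 (vol (K + ρ • M)))) (i : ℕ) :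
    Tendsto (fun k => (volInterpolant K (Z k)).coeff i) atTop
      (𝓝 ((volInterpolant K M).coeff i)) := by
  simp only [volInterpolant, Lagrange.interpolate_apply, finsetSum_coeff, coeff_C_mul]
  exact tendsto_finsetSum _ fun j _ => (h j).mul_const _

lemma tendsto_volInterpolant_eval {n : ℕ} {Z : ℕ → Body n} {M : Body n} {K : Body n}
    (h : ∀ ρ : ℝ, Tendsto (fun k => vol (K + ρ • Z k)) atTop (𝓝 (vol (K + ρ • M)))) (x : ℝ) :
    Tendsto (fun k => (volInterpolant K (Z k)).eval x) atTop
      (𝓝 ((volInterpolant K M).eval x)) := by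
  simp only [volInterpolant, Lagrange.interpolate_apply, eval_finsetSum, eval_mul, eval_C]
  exact tendsto_finsetSum _ fun j _ => (h j).mul_const _

/-! ### Approximation of the ball by zonotopes -/

/-- The support function `∑ |⟪x, v⟫|` of `zonotope l`. -/
noncomputable def zonotopeSupport {n : ℕ} (l : List (EuclideanSpace ℝ (Fin n)))
    (x : EuclideanSpace ℝ (Fin n)) : ℝ :=
  (l.map fun v => |⟪x, v⟫|).sum

lemma inner_le_zonotopeSupport {n : ℕ} (l : List (EuclideanSpace ℝ (Fin n)))
    (x : EuclideanSpace ℝ (Fin n)) : ∀ z ∈ zonotope l, ⟪x, z⟫ ≤ zonotopeSupport l x := by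
  induction l with
  | nil =>
    intro z hz
    have : z = 0 := hz
    simp [this, zonotopeSupport]
  | cons v l ih =>
    rintro _ ⟨_, ⟨a, b, ha, hb, hab, rfl⟩, z, hz, rfl⟩
    have h1 := ih z hz
    have h2 : ⟪x, a • -v + b • v⟫ ≤ |⟪x, v⟫| := by
      rw [inner_add_right, inner_smul_right, inner_smul_right, inner_neg_right]
      nlinarith [le_abs_self ⟪x, v⟫, neg_abs_le ⟪x, v⟫]
    simp only [zonotopeSupport, List.map_cons, List.sum_cons] at h1 ⊢
    rw [inner_add_right]
    linarith

lemma exists_inner_eq_zonotopeSupport {n : ℕ} (l : List (EuclideanSpace ℝ (Fin n)))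
    (x : EuclideanSpace ℝ (Fin n)) : ∃ z ∈ zonotope l, ⟪x, z⟫ = zonotopeSupport l x := by
  induction l with
  | nil => exact ⟨0, rfl, by simp [zonotopeSupport]⟩
  | cons v l ih =>
    obtain ⟨z, hz, he⟩ := ih
    have hs : ∃ y ∈ segment ℝ (-v) v, ⟪x, y⟫ = |⟪x, v⟫| := by
      rcases abs_choice ⟪x, v⟫ with h | h
      · exact ⟨v, right_mem_segment ℝ _ _, h.symm⟩
      · exact ⟨-v, left_mem_segment ℝ _ _, by rw [h, inner_neg_right]⟩
    obtain ⟨y, hy, hye⟩ := hs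
    refine ⟨y + z, ⟨y, hy, z, hz, rfl⟩, ?_⟩
    rw [inner_add_right, hye, he]
    simp [zonotopeSupport]

lemma zonotopeSupport_append {n : ℕ} (l l' : List (EuclideanSpace ℝ (Fin n)))
    (x : EuclideanSpace ℝ (Fin n)) :
    zonotopeSupport (l ++ l') x = zonotopeSupport l x + zonotopeSupport l' x := by
  simp [zonotopeSupport]

lemma zonotopeSupport_map_smul {n : ℕ} (l : List (EuclideanSpace ℝ (Fin n))) {a : ℝ} (ha : 0 ≤ a)
    (x : EuclideanSpace ℝ (Fin n)) :
    zonotopeSupport (l.map (a • ·)) x = a * zonotopeSupport l x := by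
  induction l with
  | nil => simp [zonotopeSupport]
  | cons v l ih =>
    simp only [zonotopeSupport, List.map_cons, List.sum_cons, inner_smul_right, abs_mul,
      abs_of_nonneg ha, mul_add] at ih ⊢
    rw [ih]

lemma zonotopeSupport_smul {n : ℕ} (l : List (EuclideanSpace ℝ (Fin n))) (a : ℝ)
    (x : EuclideanSpace ℝ (Fin n)) :
    zonotopeSupport l (a • x) = |a| * zonotopeSupport l x := by
  induction l with
  | nil => simp [zonotopeSupport]
  | cons v l ih =>
    simp only [zonotopeSupport, List.map_cons, List.sum_cons, real_inner_smul_left, abs_mul,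
      mul_add] at ih ⊢
    rw [ih]

/-- The function `x ↦ |⟪x, u⟫|` on the unit sphere. -/
noncomputable def sphereAbsInner {n : ℕ} (u : EuclideanSpace ℝ (Fin n)) :
    C(Metric.sphere (0 : EuclideanSpace ℝ (Fin n)) 1, ℝ) :=
  ⟨fun x => |⟪(x : EuclideanSpace ℝ (Fin n)), u⟫|, by fun_prop⟩

lemma continuous_sphereAbsInner {n : ℕ} : Continuous (sphereAbsInner (n := n)) := by
  refine ContinuousMap.continuous_of_continuous_uncurry _ ?_
  change Continuous fun p : EuclideanSpace ℝ (Fin n) ×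
    Metric.sphere (0 : EuclideanSpace ℝ (Fin n)) 1 => |⟪(p.2 : EuclideanSpace ℝ (Fin n)), p.1⟫|
  fun_prop

/-- By rotation invariance of Lebesgue measure, the average of `|⟪x, u⟫|` over `u` in the unit
ball is the same for all unit vectors `x`. -/
lemma setAverage_abs_inner_eq {n : ℕ} {x y : EuclideanSpace ℝ (Fin n)} (h : ‖x‖ = ‖y‖) :
    (⨍ u in Metric.closedBall (0 : EuclideanSpace ℝ (Fin n)) 1, |⟪x, u⟫|) =
      ⨍ u in Metric.closedBall (0 : EuclideanSpace ℝ (Fin n)) 1, |⟪y, u⟫| := by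
  rw [setAverage_eq, setAverage_eq]
  congr 1
  set R := (ℝ ∙ (x - y))ᗮ.reflection with hR
  have hxy : R x = y := Submodule.reflection_sub h
  have hpre : R ⁻¹' Metric.closedBall (0 : EuclideanSpace ℝ (Fin n)) 1 =
      Metric.closedBall 0 1 := by ext u; simp
  have := (R.measurePreserving.setIntegral_preimage_emb
    R.toHomeomorph.measurableEmbedding (fun u => |⟪y, u⟫|) (Metric.closedBall 0 1))
  rw [hpre] at this
  rw [← this]
  refine integral_congr_ae (ae_of_all _ fun u => ?_)
  dsimp only
  rw [← hxy, R.inner_map_map]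

lemma setAverage_abs_inner_pos {n : ℕ} {x : EuclideanSpace ℝ (Fin n)} (h : ‖x‖ = 1) :
    0 < ⨍ u in Metric.closedBall (0 : EuclideanSpace ℝ (Fin n)) 1, |⟪x, u⟫| := by
  have hc : Continuous fun u : EuclideanSpace ℝ (Fin n) => |⟪x, u⟫| := by fun_prop
  have hvol : 0 < volume.real (Metric.closedBall (0 : EuclideanSpace ℝ (Fin n)) 1) :=
    ENNReal.toReal_pos (Metric.measure_closedBall_pos _ _ one_pos).ne'
      measure_closedBall_lt_top.ne
  rw [setAverage_eq, smul_eq_mul]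
  refine mul_pos (inv_pos.2 hvol) ?_
  rw [setIntegral_pos_iff_support_of_nonneg_ae (ae_of_all _ fun u => abs_nonneg _)
    (hc.continuousOn.integrableOn_compact (isCompact_closedBall _ _))]
  have hopen : IsOpen ((Function.support fun u : EuclideanSpace ℝ (Fin n) => |⟪x, u⟫|) ∩
      Metric.ball 0 1) := hc.isOpen_support.inter Metric.isOpen_ball
  refine (hopen.measure_pos volume ⟨(1 / 2 : ℝ) • x, ?_, ?_⟩).trans_le
    (measure_mono (Set.inter_subset_inter_right _ Metric.ball_subset_closedBall))
  · simp [inner_smul_right, h]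
  · simp [norm_smul, h]; norm_num

/-- The restrictions to the sphere of support functions of zonotopes form a convex cone, whose
closure contains the average of the functions `|⟪·, u⟫|`. -/
lemma exists_zonotopeSupport_near {n : ℕ} {ε : ℝ} (hε : 0 < ε) :
    ∃ l : List (EuclideanSpace ℝ (Fin n)), ∀ x : EuclideanSpace ℝ (Fin n), ‖x‖ = 1 →
      |zonotopeSupport l x -
        (⨍ u in Metric.closedBall (0 : EuclideanSpace ℝ (Fin n)) 1, |⟪x, u⟫|)| < ε := by
  let S : Set C(Metric.sphere (0 : EuclideanSpace ℝ (Fin n)) 1, ℝ) :=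
    {g | ∃ l : List (EuclideanSpace ℝ (Fin n)), ∀ x, g x = zonotopeSupport l x}
  have hS : Convex ℝ S := by
    rintro f ⟨l, hl⟩ g ⟨l', hl'⟩ a b ha hb -
    refine ⟨l.map (a • ·) ++ l'.map (b • ·), fun x => ?_⟩
    rw [zonotopeSupport_append, zonotopeSupport_map_smul l ha, zonotopeSupport_map_smul l' hb]
    simp [hl, hl']
  have hint : IntegrableOn (sphereAbsInner (n := n)) (Metric.closedBall 0 1) volume :=
    continuous_sphereAbsInner.continuousOn.integrableOn_compact (isCompact_closedBall _ _)
  have hmem := hS.set_average_mem_closure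
    (Metric.measure_closedBall_pos volume (0 : EuclideanSpace ℝ (Fin n)) one_pos).ne'
    measure_closedBall_lt_top.ne
    (ae_of_all _ fun u => (⟨[u], fun x => by simp [sphereAbsInner, zonotopeSupport]⟩ :
      sphereAbsInner u ∈ S)) hint
  obtain ⟨g, ⟨l, hl⟩, hg⟩ := Metric.mem_closure_iff.1 hmem ε hε
  refine ⟨l, fun x hx => ?_⟩
  let x' : Metric.sphere (0 : EuclideanSpace ℝ (Fin n)) 1 := ⟨x, by simpa using hx⟩
  have h1 := (ContinuousMap.dist_apply_le_dist x').trans_lt hg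
  have h2 : (⨍ u in Metric.closedBall (0 : EuclideanSpace ℝ (Fin n)) 1, sphereAbsInner u) x' =
      ⨍ u in Metric.closedBall (0 : EuclideanSpace ℝ (Fin n)) 1, |⟪x, u⟫| := by
    rw [setAverage_eq, setAverage_eq, ContinuousMap.smul_apply,
      ContinuousMap.integral_apply hint]
    rfl
  rw [h2, hl, dist_comm, Real.dist_eq] at h1
  exact h1

/-- The unit ball is a limit of zonotopes. -/
lemma exists_zonotope_near_unitBall {n : ℕ} (hn : 0 < n) {ε : ℝ} (hε : 0 < ε) (hε1 : ε < 1) :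
    ∃ l : List (EuclideanSpace ℝ (Fin n)),
      (1 - ε) • unitBall n ≤ zonotope l ∧ zonotope l ≤ (1 + ε) • unitBall n := by
  let e : EuclideanSpace ℝ (Fin n) := EuclideanSpace.single ⟨0, hn⟩ 1
  have he : ‖e‖ = 1 := by simp [e]
  set c := ⨍ u in Metric.closedBall (0 : EuclideanSpace ℝ (Fin n)) 1, |⟪e, u⟫| with hc
  have hc0 : 0 < c := setAverage_abs_inner_pos he
  obtain ⟨l₀, hl₀⟩ := exists_zonotopeSupport_near (n := n) (mul_pos hc0 hε)
  set l := l₀.map (c⁻¹ • ·) with hl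
  have hunit : ∀ x : EuclideanSpace ℝ (Fin n), ‖x‖ = 1 → |zonotopeSupport l x - 1| < ε := by
    intro x hx
    have h1 := hl₀ x hx
    rw [setAverage_abs_inner_eq (hx.trans he.symm), ← hc] at h1
    rw [hl, zonotopeSupport_map_smul _ (inv_nonneg.2 hc0.le)]
    have : c⁻¹ * zonotopeSupport l₀ x - 1 = c⁻¹ * (zonotopeSupport l₀ x - c) := by field_simp
    rw [this, abs_mul, abs_of_pos (inv_pos.2 hc0), inv_mul_lt_iff₀ hc0]
    exact h1
  have hall : ∀ x : EuclideanSpace ℝ (Fin n), |zonotopeSupport l x - ‖x‖| ≤ ε * ‖x‖ := by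
    intro x
    rcases eq_or_ne x 0 with rfl | hx
    · have := zonotopeSupport_smul l 0 (0 : EuclideanSpace ℝ (Fin n))
      simp at this
      simp [this]
    · have hx' := norm_pos_iff.2 hx
      have h1 := hunit (‖x‖⁻¹ • x) (by simp [norm_smul, hx'.ne'])
      rw [zonotopeSupport_smul, abs_inv, abs_norm] at h1
      have : zonotopeSupport l x - ‖x‖ = ‖x‖ * (‖x‖⁻¹ * zonotopeSupport l x - 1) := by
        field_simp
      rw [this, abs_mul, abs_norm, mul_comm ε]
      exact mul_le_mul_of_nonneg_left h1.le hx'.le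
  refine ⟨l, ?_, ?_⟩
  · rintro _ ⟨b, hb, rfl⟩
    change (1 - ε) • b ∈ zonotope l
    have hb : ‖b‖ ≤ 1 := mem_closedBall_zero_iff.1 hb
    by_contra hmem
    obtain ⟨f, u, hfu, hu⟩ := geometric_hahn_banach_closed_point (zonotope l).convex
      (zonotope l).isClosed hmem
    set x := (InnerProductSpace.toDual ℝ (EuclideanSpace ℝ (Fin n))).symm f with hx
    have hf : ∀ y, f y = ⟪x, y⟫ := fun y => by rw [hx, InnerProductSpace.toDual_symm_apply]
    obtain ⟨z, hz, hzx⟩ := exists_inner_eq_zonotopeSupport l x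
    have h1 := hfu z hz
    have h2 := (abs_le.1 (hall x)).1
    have h3 := real_inner_le_norm x b
    have h4 : ‖x‖ * ‖b‖ ≤ ‖x‖ := mul_le_of_le_one_right (norm_nonneg x) hb
    rw [hf, hzx] at h1
    rw [hf, inner_smul_right] at hu
    have h5 : (1 - ε) * ⟪x, b⟫ ≤ (1 - ε) * ‖x‖ :=
      mul_le_mul_of_nonneg_left (h3.trans h4) (by linarith)
    linarith
  · intro z hz
    have h1 := inner_le_zonotopeSupport l z z hz
    have h2 := (abs_le.1 (hall z)).2
    rw [real_inner_self_eq_norm_sq] at h1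
    have h3 : ‖z‖ ≤ 1 + ε := by
      rcases (norm_nonneg z).eq_or_lt with h | h
      · rw [← h]; positivity
      · nlinarith
    refine ⟨(1 + ε)⁻¹ • z, ?_, smul_inv_smul₀ (by positivity) z⟩
    have : ‖(1 + ε)⁻¹ • z‖ ≤ 1 := by
      rw [norm_smul, Real.norm_of_nonneg (by positivity), inv_mul_le_iff₀ (by positivity)]
      simpa using h3
    exact mem_closedBall_zero_iff.2 this

/-! ### Existence, monotonicity and scaling of the quermassintegrals -/

lemma exists_zonotopes_tendsto_vol {n : ℕ} (hn : 0 < n) :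
    ∃ l : ℕ → List (EuclideanSpace ℝ (Fin n)), ∀ (K : Body n) (ρ : ℝ),
      Tendsto (fun k => vol (K + ρ • zonotope (l k))) atTop (𝓝 (vol (K + ρ • unitBall n))) := by
  have hpos : ∀ k : ℕ, (0 : ℝ) < 1 / ((k : ℝ) + 2) := fun k => by positivity
  have hlt : ∀ k : ℕ, 1 / ((k : ℝ) + 2) < 1 := fun k => by
    rw [div_lt_one (by positivity)]
    linarith [(Nat.cast_nonneg k : (0 : ℝ) ≤ k)]
  choose l hl using fun k : ℕ => exists_zonotope_near_unitBall hn (hpos k) (hlt k)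
  have hlim : Tendsto (fun k : ℕ => 1 / ((k : ℝ) + 2)) atTop (𝓝 0) := by
    simp only [one_div]
    exact tendsto_inv_atTop_zero.comp
      (tendsto_atTop_add_const_right _ _ tendsto_natCast_atTop_atTop)
  exact ⟨l, tendsto_vol_add_smul hlim hpos hlt hl⟩

/-- The Steiner formula, as the limit of the polynomial expansions along zonotopes. -/
lemma isSteinerPolynomial_volInterpolant {n : ℕ} (hn : 0 < n) (K : Body n) :
    IsSteinerPolynomial K (volInterpolant K (unitBall n)) := by
  intro ρ hρ
  obtain ⟨l, hl⟩ := exists_zonotopes_tendsto_vol hn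
  refine tendsto_nhds_unique (hl K ρ) ?_
  have h : ∀ k, vol (K + ρ • zonotope (l k)) =
      (volInterpolant K (zonotope (l k))).eval ρ := fun k => by
    obtain ⟨p, hp, -⟩ := isSegmentAffine_vol.exists_polynomial (l k)
    rw [← eq_volInterpolant K _ (hp K), hp K ρ hρ]
  simp only [h]
  exact tendsto_volInterpolant_eval (hl K) ρ

lemma isSteinerPolynomial_steinerPolynomial {n : ℕ} (hn : 0 < n) (K : Body n) :
    IsSteinerPolynomial K (steinerPolynomial K) := by
  have h : ∃ p : ℝ[X], IsSteinerPolynomial K p := ⟨_, isSteinerPolynomial_volInterpolant hn K⟩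
  rw [steinerPolynomial, dif_pos h]
  exact h.choose_spec

lemma steinerPolynomial_eq_volInterpolant {n : ℕ} (hn : 0 < n) (K : Body n) :
    steinerPolynomial K = volInterpolant K (unitBall n) :=
  (isSteinerPolynomial_steinerPolynomial hn K).unique (isSteinerPolynomial_volInterpolant hn K)

lemma vol_parallel_eq_sum_quermassintegral {n : ℕ} (hn : 0 < n) (K : Body n) {ρ : ℝ}
    (hρ : 0 ≤ ρ) : vol (K + ρ • unitBall n) =
      ∑ i ∈ Finset.range (n + 1), ρ ^ i * (n.choose i : ℝ) * quermassintegral i K := by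
  have hdeg : (steinerPolynomial K).natDegree < n + 1 :=
    Nat.lt_succ_of_le (natDegree_le_of_degree_le
      (degree_le_of_eval_eq_vol K (unitBall n) (isSteinerPolynomial_steinerPolynomial hn K)))
  rw [isSteinerPolynomial_steinerPolynomial hn K ρ hρ, eval_eq_sum_range' hdeg]
  refine Finset.sum_congr rfl fun i hi => ?_
  have : (n.choose i : ℝ) ≠ 0 := by
    exact_mod_cast (Nat.choose_pos (Nat.lt_succ_iff.1 (Finset.mem_range.1 hi))).ne'
  rw [quermassintegral, mul_assoc, mul_div_cancel₀ _ this, mul_comm]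

lemma vol_eq_quermassintegral_zero {n : ℕ} (hn : 0 < n) (K : Body n) :
    vol K = quermassintegral 0 K := by
  have h := isSteinerPolynomial_steinerPolynomial hn K 0 le_rfl
  have h0 : K + (0 : ℝ) • unitBall n = K := by
    apply ConvexBody.ext
    rw [ConvexBody.coe_add, ConvexBody.coe_smul, Set.zero_smul_set (unitBall n).nonempty, add_zero]
  rw [h0, ← Polynomial.coeff_zero_eq_eval_zero] at h
  simp [quermassintegral, h]

/-- Monotonicity passes to the limit from the coefficients of the expansions along zonotopes. -/
lemma quermassintegral_mono {n : ℕ} (hn : 0 < n) (i : ℕ) :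
    Monotone (quermassintegral i : Body n → ℝ) := by
  intro K L h
  refine div_le_div_of_nonneg_right ?_ (Nat.cast_nonneg _)
  rw [steinerPolynomial_eq_volInterpolant hn, steinerPolynomial_eq_volInterpolant hn]
  obtain ⟨l, hl⟩ := exists_zonotopes_tendsto_vol hn
  refine le_of_tendsto_of_tendsto' (tendsto_volInterpolant_coeff (hl K) i)
    (tendsto_volInterpolant_coeff (hl L) i) fun k => ?_
  obtain ⟨p, hp, hpm⟩ := isSegmentAffine_vol.exists_polynomial (l k)
  rw [← eq_volInterpolant K _ (hp K), ← eq_volInterpolant L _ (hp L)]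
  exact hpm i h

lemma smul_unitBall_eq_of_abs_eq {n : ℕ} {a b : ℝ} (h : |a| = |b|) :
    a • unitBall n = b • unitBall n := by
  apply ConvexBody.ext
  rw [ConvexBody.coe_smul, ConvexBody.coe_smul]
  change a • Metric.closedBall (0 : EuclideanSpace ℝ (Fin n)) 1 = b • Metric.closedBall 0 1
  rw [smul_unitClosedBall, smul_unitClosedBall, Real.norm_eq_abs, Real.norm_eq_abs, h]

/-- Quermassintegrals are translation invariant and homogeneous of degree `n - i`, also under
negative dilation factors because the unit ball is symmetric. -/
lemma quermassintegral_eq_of_homothetic {n : ℕ} (hn : 0 < n) (i : ℕ) {K L : Body n} {r : ℝ}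
    (hr : r ≠ 0) (x : EuclideanSpace ℝ (Fin n))
    (hL : (L : Set (EuclideanSpace ℝ (Fin n))) = (fun y => x + y) '' (r • K : Body n)) :
    quermassintegral i L = |r| ^ n * |r|⁻¹ ^ i * quermassintegral i K := by
  have hr' : |r| ≠ 0 := abs_ne_zero.2 hr
  have hst : IsSteinerPolynomial L
      (C (|r| ^ n) * (steinerPolynomial K).comp (C |r|⁻¹ * X)) := by
    intro ρ hρ
    have hρ' : 0 ≤ |r|⁻¹ * ρ := by positivity
    rw [eval_mul, eval_C, eval_comp, eval_mul, eval_C, eval_X,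
      ← isSteinerPolynomial_steinerPolynomial hn K _ hρ', ← vol_smul, smul_add, smul_smul,
      smul_unitBall_eq_of_abs_eq (n := n) (a := r * (|r|⁻¹ * ρ)) (b := ρ), vol, vol,
      ← measureReal_image_add_left x ((r • K + ρ • unitBall n : Body n) : Set _)]
    · congr 1
      rw [ConvexBody.coe_add, ConvexBody.coe_add, hL]
      ext z
      constructor
      · rintro ⟨_, ⟨k, hk, rfl⟩, b, hb, rfl⟩
        exact ⟨k + b, ⟨k, hk, b, hb, rfl⟩, (add_assoc _ _ _).symm⟩
      · rintro ⟨_, ⟨k, hk, b, hb, rfl⟩, rfl⟩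
        exact ⟨_, ⟨k, hk, rfl⟩, b, hb, add_assoc _ _ _⟩
    · rw [abs_mul, abs_mul, abs_inv, abs_abs, ← mul_assoc, mul_inv_cancel₀ hr', one_mul]
  rw [quermassintegral, (isSteinerPolynomial_steinerPolynomial hn L).unique hst, coeff_C_mul,
    comp_C_mul_X_coeff, quermassintegral]
  ring

/-- An operator for which `D K` always contains a translate of `r K`, with a fixed `r ≠ 0`,
satisfies the inequality for every quermassintegral. -/
lemma satisfiesBM_quermassintegral_of_homothetic {n : ℕ} (hn : 0 < n) {D : Body n → Body n}
    {r : ℝ} (hr : r ≠ 0)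
    (hD : ∀ K : Body n, ∃ x : EuclideanSpace ℝ (Fin n), ∀ k ∈ K, x + r • k ∈ D K) (i : ℕ) :
    SatisfiesBM (quermassintegral i) D := by
  have hr' : 0 < |r| := abs_pos.2 hr
  refine ⟨(|r| ^ n * |r|⁻¹ ^ i)⁻¹, by positivity, fun K => ?_⟩
  obtain ⟨x, hx⟩ := hD K
  let L : Body n :=
    { carrier := (fun y => x + y) '' (r • K : Body n)
      convex' := (r • K).convex.translate x
      isCompact' := (r • K).isCompact.image (continuous_const.add continuous_id)
      nonempty' := (r • K).nonempty.image _ }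
  have hLD : L ≤ D K := by
    rintro _ ⟨_, ⟨k, hk, rfl⟩, rfl⟩
    exact hx k hk
  rw [le_inv_mul_iff₀ (by positivity), ← quermassintegral_eq_of_homothetic hn i hr x (L := L) rfl]
  exact quermassintegral_mono hn i hLD

/-! ### Covariance under singular linear maps -/

/-- The image of a convex body under a linear map, not necessarily invertible. -/
def linearMapImage {n : ℕ} (A : EuclideanSpace ℝ (Fin n) →ₗ[ℝ] EuclideanSpace ℝ (Fin n))
    (K : Body n) : Body n where
  carrier := A '' (K : Set (EuclideanSpace ℝ (Fin n)))
  convex' := K.convex.linear_image A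
  isCompact' := K.isCompact.image A.continuous_of_finiteDimensional
  nonempty' := K.nonempty.image A

lemma tendsto_linearMapImage_add_smul {n : ℕ}
    (A : EuclideanSpace ℝ (Fin n) →ₗ[ℝ] EuclideanSpace ℝ (Fin n)) (K : Body n) :
    Tendsto (fun t : ℝ => linearMapImage (A + t • 1) K) (𝓝 0) (𝓝 (linearMapImage A K)) := by
  obtain ⟨R, hR, hKR⟩ := K.isBounded.exists_pos_norm_le
  have hle : ∀ t : ℝ, dist (linearMapImage (A + t • 1) K) (linearMapImage A K) ≤ |t| * R := by
    intro t
    have hd : ∀ k ∈ K, dist ((A + t • 1) k) (A k) ≤ |t| * R := by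
      intro k hk
      simp only [dist_eq_norm, LinearMap.add_apply, LinearMap.smul_apply, Module.End.one_apply,
        add_sub_cancel_left, norm_smul, Real.norm_eq_abs]
      exact mul_le_mul_of_nonneg_left (hKR k hk) (abs_nonneg t)
    rw [← ConvexBody.hausdorffDist_coe]
    refine Metric.hausdorffDist_le_of_mem_dist (by positivity) ?_ ?_
    · rintro _ ⟨k, hk, rfl⟩
      exact ⟨A k, ⟨k, hk, rfl⟩, hd k hk⟩
    · rintro _ ⟨k, hk, rfl⟩
      exact ⟨(A + t • 1) k, ⟨k, hk, rfl⟩, by rw [dist_comm]; exact hd k hk⟩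
  rw [tendsto_iff_dist_tendsto_zero]
  refine squeeze_zero (fun _ => dist_nonneg) hle ?_
  have : Continuous fun t : ℝ => |t| * R := by fun_prop
  simpa using this.tendsto 0

lemma frequently_bijective_add_smul {n : ℕ}
    (A : EuclideanSpace ℝ (Fin n) →ₗ[ℝ] EuclideanSpace ℝ (Fin n)) :
    ∃ᶠ t : ℝ in 𝓝 0,
      Function.Bijective ⇑(A + t • (1 : Module.End ℝ (EuclideanSpace ℝ (Fin n)))) := by
  have hfin : {t : ℝ | ¬ Function.Bijective
      ⇑(A + t • (1 : Module.End ℝ (EuclideanSpace ℝ (Fin n))))}.Finite := by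
    refine ((Module.End.finite_spectrum A).image Neg.neg).subset fun t ht => ⟨-t, ?_, neg_neg t⟩
    rw [spectrum.mem_iff]
    intro hu
    apply ht
    rw [← Module.End.isUnit_iff]
    have he : A + t • (1 : Module.End ℝ (EuclideanSpace ℝ (Fin n))) =
        -(algebraMap ℝ (Module.End ℝ (EuclideanSpace ℝ (Fin n))) (-t) - A) := by
      rw [Algebra.algebraMap_eq_smul_one]
      module
    rw [he]
    exact hu.neg
  have h := mem_closure_iff_frequently.1 ((hfin.countable.dense_compl ℝ) 0)
  exact h.mono fun t ht => not_not.1 ht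

/-- By continuity and density of `GL(n)`, a continuous `GL(n)`-covariant operator commutes with
all linear maps. -/
lemma map_linearMapImage {n : ℕ} {D : Body n → Body n} (hcont : Continuous D)
    (hcov : IsGLCovariant D) (A : EuclideanSpace ℝ (Fin n) →ₗ[ℝ] EuclideanSpace ℝ (Fin n))
    (K : Body n) : D (linearMapImage A K) = linearMapImage A (D K) := by
  refine tendsto_nhds_unique_of_frequently_eq
    ((hcont.tendsto _).comp (tendsto_linearMapImage_add_smul A K))
    (tendsto_linearMapImage_add_smul A (D K)) ?_
  refine (frequently_bijective_add_smul A).mono fun t ht => ?_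
  let B : EuclideanSpace ℝ (Fin n) →ₗ[ℝ] EuclideanSpace ℝ (Fin n) := A + t • 1
  exact hcov (LinearEquiv.ofBijective B ht) K

/-- The image of `D K` under a linear functional depends only on the image of `K`. -/
lemma image_map_eq_image_map {n : ℕ} (hn : 0 < n) {D : Body n → Body n} (hcont : Continuous D)
    (hcov : IsGLCovariant D) {f g : EuclideanSpace ℝ (Fin n) →ₗ[ℝ] ℝ} {K L : Body n}
    (h : f '' (K : Set (EuclideanSpace ℝ (Fin n))) = g '' (L : Set (EuclideanSpace ℝ (Fin n)))) :
    f '' (D K : Set (EuclideanSpace ℝ (Fin n))) = g '' (D L : Set (EuclideanSpace ℝ (Fin n))) := by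
  let e : EuclideanSpace ℝ (Fin n) := EuclideanSpace.single ⟨0, hn⟩ 1
  have himg : ∀ (f : EuclideanSpace ℝ (Fin n) →ₗ[ℝ] ℝ) (K : Body n),
      (linearMapImage (f.smulRight e) K : Set (EuclideanSpace ℝ (Fin n))) =
        (fun t : ℝ => t • e) '' (f '' (K : Set (EuclideanSpace ℝ (Fin n)))) := by
    intro f K
    rw [Set.image_image]
    rfl
  have h1 : linearMapImage (f.smulRight e) K = linearMapImage (g.smulRight e) L :=
    ConvexBody.ext (by rw [himg, himg, h])
  have h2 := congrArg (fun M : Body n => (M : Set (EuclideanSpace ℝ (Fin n)))) (congrArg D h1)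
  simp only [map_linearMapImage hcont hcov, himg] at h2
  refine Set.image_injective.2 (fun s t hst => ?_) h2
  simpa [e] using congrArg (fun v : EuclideanSpace ℝ (Fin n) => v ⟨0, hn⟩) hst

/-! ### The body associated with a segment -/

/-- The convex hull of a finite nonempty set. -/
def hullBody {n : ℕ} (s : Set (EuclideanSpace ℝ (Fin n))) (hs : s.Finite) (hne : s.Nonempty) :
    Body n where
  carrier := convexHull ℝ s
  convex' := convex_convexHull ℝ s
  isCompact' := hs.isCompact_convexHull ℝ
  nonempty' := hne.convexHull

lemma image_convexHull_eq_Icc {E : Type*} [AddCommGroup E] [Module ℝ E] {s : Set E}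
    (f : E →ₗ[ℝ] ℝ) {a b : ℝ} (ha : ∃ p ∈ s, f p = a) (hb : ∃ q ∈ s, f q = b)
    (h : ∀ x ∈ s, a ≤ f x ∧ f x ≤ b) : f '' convexHull ℝ s = Set.Icc a b := by
  rw [f.image_convexHull]
  refine (convexHull_min ?_ (convex_Icc a b)).antisymm ?_
  · rintro _ ⟨x, hx, rfl⟩
    exact h x hx
  · exact (convex_convexHull ℝ _).ordConnected.out (subset_convexHull ℝ _ ha)
      (subset_convexHull ℝ _ hb)

/-- If the body `T` looks like `K` through `φ` in direction `f`, and like `K` through `ψ` in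
both directions `f ± h`, then midpoint convexity of the support function of `D T` at `f` bounds
`φ` by `ψ` at the points of `D K` where `ψ` is maximal. -/
lemma le_of_isMaxOn_of_image_eq {n : ℕ} (hn : 0 < n) {D : Body n → Body n} (hcont : Continuous D)
    (hcov : IsGLCovariant D) {f h φ ψ : EuclideanSpace ℝ (Fin n) →ₗ[ℝ] ℝ} {T K : Body n}
    (h0 : f '' (T : Set (EuclideanSpace ℝ (Fin n))) = φ '' (K : Set (EuclideanSpace ℝ (Fin n))))
    (h1 : (f + h) '' (T : Set (EuclideanSpace ℝ (Fin n))) =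
      ψ '' (K : Set (EuclideanSpace ℝ (Fin n))))
    (h2 : (f - h) '' (T : Set (EuclideanSpace ℝ (Fin n))) =
      ψ '' (K : Set (EuclideanSpace ℝ (Fin n))))
    {m : EuclideanSpace ℝ (Fin n)} (hm : m ∈ D K) (hmax : ∀ y ∈ D K, ψ y ≤ ψ m) :
    φ m ≤ ψ m := by
  have e0 := image_map_eq_image_map hn hcont hcov h0
  have e1 := image_map_eq_image_map hn hcont hcov h1
  have e2 := image_map_eq_image_map hn hcont hcov h2
  obtain ⟨t, ht, htm⟩ := e0.symm.subset ⟨m, hm, rfl⟩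
  obtain ⟨y, hy, hyt⟩ := e1.subset ⟨t, ht, rfl⟩
  obtain ⟨z, hz, hzt⟩ := e2.subset ⟨t, ht, rfl⟩
  have := hmax y hy
  have := hmax z hz
  simp only [LinearMap.add_apply, LinearMap.sub_apply] at hyt hzt
  linarith

/-- Points of `D [e, e']` that are maximal for `a p + b q`, `a < b`, where `(p, q)` is the pair of
coordinates dual to `(e, e')`, have coordinates of opposite signs. Each sign is obtained from a
triangle one of whose two horizontal extremes is a vertical edge. -/
lemma sign_of_isMaxOn {n : ℕ} (hn : 0 < n) {D : Body n → Body n} (hcont : Continuous D)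
    (hcov : IsGLCovariant D) {e e' : EuclideanSpace ℝ (Fin n)}
    {p q : EuclideanSpace ℝ (Fin n) →ₗ[ℝ] ℝ} (hpe : p e = 1) (hpe' : p e' = 0) (hqe : q e = 0)
    (hqe' : q e' = 1) {a b : ℝ} (hab : a < b) {I : Body n}
    (hI : ∀ c d : ℝ, c ≤ d →
      (c • p + d • q) '' (I : Set (EuclideanSpace ℝ (Fin n))) = Set.Icc c d)
    {m : EuclideanSpace ℝ (Fin n)} (hm : m ∈ D I)
    (hmax : ∀ y ∈ D I, (a • p + b • q) y ≤ (a • p + b • q) m) : p m ≤ 0 ∧ 0 ≤ q m := by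
  set c := (a + b) / 2 with hc
  set δ := (b - a) / 2 with hδ
  have hδ0 : 0 < δ := by rw [hδ]; linarith
  constructor
  · let T := hullBody {b • e, c • e + e', c • e - e'} (by simp) (by simp)
    have h := le_of_isMaxOn_of_image_eq hn hcont hcov (f := p) (h := δ • q) (T := T) (K := I)
      (φ := c • p + b • q) (ψ := a • p + b • q) ?_ ?_ ?_ hm hmax
    · simp only [LinearMap.add_apply, LinearMap.smul_apply, smul_eq_mul] at h
      nlinarith
    · rw [hI _ _ (by linarith)]
      refine image_convexHull_eq_Icc _ ⟨c • e + e', by simp, by simp [hpe, hpe']⟩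
        ⟨b • e, by simp, by simp [hpe]⟩ ?_
      simp only [Set.mem_insert_iff, Set.mem_singleton_iff, forall_eq_or_imp, forall_eq, map_add,
        map_sub, map_smul, hpe, hpe', smul_eq_mul]
      refine ⟨⟨?_, ?_⟩, ⟨?_, ?_⟩, ?_, ?_⟩ <;> linarith
    · rw [hI _ _ hab.le]
      refine image_convexHull_eq_Icc _ ⟨c • e - e', by simp, ?_⟩
        ⟨b • e, by simp, by simp [hpe, hqe]⟩ ?_
      · simp [hpe, hpe', hqe, hqe', hc, hδ]; ring
      simp only [Set.mem_insert_iff, Set.mem_singleton_iff, forall_eq_or_imp, forall_eq, map_add,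
        map_sub, map_smul, hpe, hpe', hqe, hqe', smul_eq_mul, LinearMap.add_apply,
        LinearMap.smul_apply]
      refine ⟨⟨?_, ?_⟩, ⟨?_, ?_⟩, ?_, ?_⟩ <;> linarith
    · rw [hI _ _ hab.le]
      refine image_convexHull_eq_Icc _ ⟨c • e + e', by simp, ?_⟩
        ⟨b • e, by simp, by simp [hpe, hqe]⟩ ?_
      · simp [hpe, hpe', hqe, hqe', hc, hδ]; ring
      simp only [Set.mem_insert_iff, Set.mem_singleton_iff, forall_eq_or_imp, forall_eq, map_add,
        map_sub, map_smul, hpe, hpe', hqe, hqe', smul_eq_mul, LinearMap.sub_apply,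
        LinearMap.smul_apply]
      refine ⟨⟨?_, ?_⟩, ⟨?_, ?_⟩, ?_, ?_⟩ <;> linarith
  · let T := hullBody {a • e, c • e + e', c • e - e'} (by simp) (by simp)
    have h := le_of_isMaxOn_of_image_eq hn hcont hcov (f := p) (h := δ • q) (T := T) (K := I)
      (φ := a • p + c • q) (ψ := a • p + b • q) ?_ ?_ ?_ hm hmax
    · simp only [LinearMap.add_apply, LinearMap.smul_apply, smul_eq_mul] at h
      nlinarith
    · rw [hI _ _ (by linarith)]
      refine image_convexHull_eq_Icc _ ⟨a • e, by simp, by simp [hpe]⟩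
        ⟨c • e + e', by simp, by simp [hpe, hpe']⟩ ?_
      simp only [Set.mem_insert_iff, Set.mem_singleton_iff, forall_eq_or_imp, forall_eq, map_add,
        map_sub, map_smul, hpe, hpe', smul_eq_mul]
      refine ⟨⟨?_, ?_⟩, ⟨?_, ?_⟩, ?_, ?_⟩ <;> linarith
    · rw [hI _ _ hab.le]
      refine image_convexHull_eq_Icc _ ⟨a • e, by simp, by simp [hpe, hqe]⟩
        ⟨c • e + e', by simp, ?_⟩ ?_
      · simp [hpe, hpe', hqe, hqe', hc, hδ]; ring
      simp only [Set.mem_insert_iff, Set.mem_singleton_iff, forall_eq_or_imp, forall_eq, map_add,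
        map_sub, map_smul, hpe, hpe', hqe, hqe', smul_eq_mul, LinearMap.add_apply,
        LinearMap.smul_apply]
      refine ⟨⟨?_, ?_⟩, ⟨?_, ?_⟩, ?_, ?_⟩ <;> linarith
    · rw [hI _ _ hab.le]
      refine image_convexHull_eq_Icc _ ⟨a • e, by simp, by simp [hpe, hqe]⟩
        ⟨c • e - e', by simp, ?_⟩ ?_
      · simp [hpe, hpe', hqe, hqe', hc, hδ]; ring
      simp only [Set.mem_insert_iff, Set.mem_singleton_iff, forall_eq_or_imp, forall_eq, map_add,
        map_sub, map_smul, hpe, hpe', hqe, hqe', smul_eq_mul, LinearMap.sub_apply,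
        LinearMap.smul_apply]
      refine ⟨⟨?_, ?_⟩, ⟨?_, ?_⟩, ?_, ?_⟩ <;> linarith

/-- A linear functional maps a convex body onto a compact interval. -/
lemma exists_image_eq_Icc {n : ℕ} (f : EuclideanSpace ℝ (Fin n) →ₗ[ℝ] ℝ) (K : Body n) :
    ∃ a b : ℝ, a ≤ b ∧ f '' (K : Set (EuclideanSpace ℝ (Fin n))) = Set.Icc a b := by
  have hf := f.continuous_of_finiteDimensional.continuousOn (s := (K : Set _))
  obtain ⟨x, hx, hxm⟩ := K.isCompact.exists_isMinOn K.nonempty hf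
  obtain ⟨y, hy, hym⟩ := K.isCompact.exists_isMaxOn K.nonempty hf
  refine ⟨f x, f y, hxm hy, ?_⟩
  have := image_convexHull_eq_Icc f (s := (K : Set _)) ⟨x, hx, rfl⟩ ⟨y, hy, rfl⟩
    fun z hz => ⟨hxm hz, hym hz⟩
  rwa [K.convex.convexHull_eq] at this

/-- The pair `(s, t)` consists of the coordinates of a point of `D [e, e']` with `s ≤ 0 ≤ t`, so that
`s f(k) + t f(k')` is at most the maximum of `f` on `D K` for every linear functional `f`. -/
lemma exists_smul_add_smul_mem {n : ℕ} (hn : 2 ≤ n) {D : Body n → Body n} (hcont : Continuous D)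
    (hcov : IsGLCovariant D) (hnontriv : ¬ IsTrivial D) :
    ∃ s t : ℝ, (s ≠ 0 ∨ t ≠ 0) ∧ ∀ K : Body n, ∀ k ∈ K, ∀ k' ∈ K, s • k + t • k' ∈ D K := by
  have hn0 : 0 < n := by omega
  let i₀ : Fin n := ⟨0, hn0⟩
  let i₁ : Fin n := ⟨1, hn⟩
  have h01 : i₀ ≠ i₁ := by simp [i₀, i₁]
  let e : EuclideanSpace ℝ (Fin n) := EuclideanSpace.single i₀ 1
  let e' : EuclideanSpace ℝ (Fin n) := EuclideanSpace.single i₁ 1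
  let p : EuclideanSpace ℝ (Fin n) →ₗ[ℝ] ℝ := (EuclideanSpace.proj (𝕜 := ℝ) i₀).toLinearMap
  let q : EuclideanSpace ℝ (Fin n) →ₗ[ℝ] ℝ := (EuclideanSpace.proj (𝕜 := ℝ) i₁).toLinearMap
  have hpe : p e = 1 := by simp [p, e]
  have hpe' : p e' = 0 := by simp [p, e', h01]
  have hqe : q e = 0 := by simp [q, e, h01.symm]
  have hqe' : q e' = 1 := by simp [q, e']
  let I : Body n := hullBody {e, e'} (by simp) (by simp)
  have hI : ∀ c d : ℝ, c ≤ d →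
      (c • p + d • q) '' (I : Set (EuclideanSpace ℝ (Fin n))) = Set.Icc c d := by
    intro c d hcd
    refine image_convexHull_eq_Icc _ ⟨e, by simp, by simp [hpe, hqe]⟩
      ⟨e', by simp, by simp [hpe', hqe']⟩ ?_
    simp [hpe, hpe', hqe, hqe', hcd]
  have hI' : ∀ c d : ℝ, c ≤ d →
      (d • p + c • q) '' (I : Set (EuclideanSpace ℝ (Fin n))) = Set.Icc c d := by
    intro c d hcd
    refine image_convexHull_eq_Icc _ ⟨e', by simp, by simp [hpe', hqe']⟩
      ⟨e, by simp, by simp [hpe, hqe]⟩ ?_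
    simp [hpe, hpe', hqe, hqe', hcd]
  -- the image of `D K` under `f` is an image of `D I`
  have himg : ∀ (f : EuclideanSpace ℝ (Fin n) →ₗ[ℝ] ℝ) (K : Body n), ∃ a b : ℝ,
      f '' (K : Set (EuclideanSpace ℝ (Fin n))) = Set.Icc a b ∧
      f '' (D K : Set (EuclideanSpace ℝ (Fin n))) =
        (a • p + b • q) '' (D I : Set (EuclideanSpace ℝ (Fin n))) := by
    intro f K
    obtain ⟨a, b, hab, h⟩ := exists_image_eq_Icc f K
    exact ⟨a, b, h, image_map_eq_image_map hn0 hcont hcov (h.trans (hI a b hab).symm)⟩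
  have hmaxex : ∀ f : EuclideanSpace ℝ (Fin n) →ₗ[ℝ] ℝ, ∃ m ∈ D I, ∀ y ∈ D I, f y ≤ f m :=
    fun f => (D I).isCompact.exists_isMaxOn (D I).nonempty
      f.continuous_of_finiteDimensional.continuousOn
  obtain ⟨m, hm, hmp, hmq, hm0⟩ : ∃ m ∈ D I, p m ≤ 0 ∧ 0 ≤ q m ∧ (p m ≠ 0 ∨ q m ≠ 0) := by
    obtain ⟨m, hm, hmax⟩ := hmaxex ((0 : ℝ) • p + (1 : ℝ) • q)
    obtain ⟨m', hm', hmax'⟩ := hmaxex ((-1 : ℝ) • p + (0 : ℝ) • q)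
    obtain ⟨s1, s2⟩ := sign_of_isMaxOn hn0 hcont hcov hpe hpe' hqe hqe' zero_lt_one hI hm hmax
    obtain ⟨s1', s2'⟩ := sign_of_isMaxOn hn0 hcont hcov hpe hpe' hqe hqe'
      (show (-1 : ℝ) < 0 by norm_num) hI hm' hmax'
    by_contra! hcon
    obtain ⟨z1, z2⟩ := hcon m hm s1 s2
    obtain ⟨z1', z2'⟩ := hcon m' hm' s1' s2'
    -- both maxima vanish; the swap symmetry of `I` then forces both coordinates to vanish on `D I`
    have hsymm := image_map_eq_image_map hn0 hcont hcov
      ((hI 0 1 zero_le_one).trans (hI' 0 1 zero_le_one).symm)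
    have hsymm' := image_map_eq_image_map hn0 hcont hcov
      ((hI (-1) 0 (by norm_num)).trans (hI' (-1) 0 (by norm_num)).symm)
    have hzero : ∀ y ∈ D I, p y = 0 ∧ q y = 0 := by
      intro y hy
      have b1 := hmax y hy
      have b2 := hmax' y hy
      obtain ⟨w, hw, hwy⟩ := hsymm.symm.subset ⟨y, hy, rfl⟩
      obtain ⟨w', hw', hwy'⟩ := hsymm'.symm.subset ⟨y, hy, rfl⟩
      have b3 := hmax w hw
      have b4 := hmax' w' hw'
      simp only [LinearMap.add_apply, LinearMap.smul_apply, smul_eq_mul] at b1 b2 b3 b4 hwy hwy'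
      constructor <;> linarith
    refine hnontriv fun K => ?_
    have hK : ∀ x ∈ D K, x = 0 := by
      intro x hx
      ext i
      obtain ⟨a, b, -, h⟩ := himg (EuclideanSpace.proj (𝕜 := ℝ) i).toLinearMap K
      obtain ⟨y, hy, hyx⟩ := h.subset ⟨x, hx, rfl⟩
      simp only [LinearMap.add_apply, LinearMap.smul_apply, (hzero y hy).1, (hzero y hy).2] at hyx
      simpa using hyx.symm
    apply ConvexBody.ext
    rw [ConvexBody.coe_zero]
    exact (D K).nonempty.subset_zero_iff.1 hK
  refine ⟨p m, q m, hm0, fun K k hk k' hk' => ?_⟩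
  by_contra hnot
  obtain ⟨f, u, hfu, hu⟩ := geometric_hahn_banach_closed_point (D K).convex (D K).isClosed hnot
  obtain ⟨a, b, hab, h⟩ := himg f.toLinearMap K
  obtain ⟨z, hz, hzm⟩ := h.symm.subset ⟨m, hm, rfl⟩
  have h1 : f k ∈ Set.Icc a b := hab.subset ⟨k, hk, rfl⟩
  have h2 : f k' ∈ Set.Icc a b := hab.subset ⟨k', hk', rfl⟩
  have h3 := hfu z hz
  have h4 : f z = a * p m + b * q m := hzm
  rw [map_add, map_smul, map_smul, smul_eq_mul, smul_eq_mul] at hu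
  nlinarith [h1.1, h2.2, mul_nonneg (neg_nonneg.2 hmp) (sub_nonneg.2 h1.1),
    mul_nonneg hmq (sub_nonneg.2 h2.2)]

/-! ### The inequality -/

lemma exists_homothetic_subset {n : ℕ} (hn : 2 ≤ n) {D : Body n → Body n} (hcont : Continuous D)
    (hcov : IsGLCovariant D) (hnontriv : ¬ IsTrivial D) :
    ∃ r : ℝ, r ≠ 0 ∧ ∀ K : Body n, ∃ x : EuclideanSpace ℝ (Fin n), ∀ k ∈ K, x + r • k ∈ D K := by
  obtain ⟨s, t, hst, h⟩ := exists_smul_add_smul_mem hn hcont hcov hnontriv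
  rcases hst with hs | ht
  · refine ⟨s, hs, fun K => ?_⟩
    obtain ⟨k₀, hk₀⟩ := K.nonempty
    exact ⟨t • k₀, fun k hk => by rw [add_comm]; exact h K k hk k₀ hk₀⟩
  · refine ⟨t, ht, fun K => ?_⟩
    obtain ⟨k₀, hk₀⟩ := K.nonempty
    exact ⟨s • k₀, fun k hk => h K k₀ hk₀ k hk⟩

end QuermassBM

theorem theorem4p2 (n : ℕ) (hn : 2 ≤ n) (D : QuermassBM.Body n → QuermassBM.Body n)
    (hcont : Continuous D) (hcov : QuermassBM.IsGLCovariant D)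
    (hnontriv : ¬ QuermassBM.IsTrivial D) :
    (∀ (K : QuermassBM.Body n) (ρ : ℝ), 0 ≤ ρ →
      QuermassBM.vol (K + ρ • QuermassBM.unitBall n) =
        ∑ i ∈ Finset.range (n + 1),
          ρ ^ i * (n.choose i : ℝ) * QuermassBM.quermassintegral i K) ∧
    (∀ i : ℕ, i < n → QuermassBM.SatisfiesBM (QuermassBM.quermassintegral i) D) ∧
    QuermassBM.SatisfiesBM QuermassBM.vol D := by
  have hn0 : 0 < n := by omega
  obtain ⟨r, hr, hD⟩ := QuermassBM.exists_homothetic_subset hn hcont hcov hnontriv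
  have hW := QuermassBM.satisfiesBM_quermassintegral_of_homothetic hn0 hr hD
  refine ⟨fun K ρ hρ => QuermassBM.vol_parallel_eq_sum_quermassintegral hn0 K hρ,
    fun i _ => hW i, ?_⟩
  rw [show (QuermassBM.vol : QuermassBM.Body n → ℝ) = QuermassBM.quermassintegral 0 from
    funext (QuermassBM.vol_eq_quermassintegral_zero hn0)]
  exact hW 0
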